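/- Let $d\ge 0$ be an integer, let $\alpha\in(0,1]$, and put $\beta:=1-(1-\alpha)^{1/(d+1)}$. (a) Let $\mathcal F_1,\dots,\mathcal F_{d+1}$ be finite nonempty families of convex sets in $\mathbb R^d$, of sizes $n_1,\dots,n_{d+1}$ respectively (repetitions of sets are allowed and are counted with multiplicity). A colorful $(d+1)$-tuple is a choice of one member $F_i\in\mathcal F_i$ for every $i\in\{1,\dots,d+1\}$; there are $n_1\cdots n_{d+1}$ of them. If at least $\alpha\, n_1\cdots n_{d+1}$ of the colorful $(d+1)$-tuples satisfy $F_1\cap\dots\cap F_{d+1}\neq\emptyset$, then there is $i\in\{1,\dots,d+1\}$ such that $\mathcal F_i$ contains a subfamily of size at least $\beta\, n_i$ with nonempty intersection. (b) The same result in terms of nerves. The nerve of a finite family of sets in $\mathbb R^d$ is the simplicial complex whose vertices are the members of the family (repeated sets give distinct vertices) and whose faces are the subfamilies with nonempty intersection; the empty subfamily, whose intersection is $\mathbb R^d$, is a face. A simplicial complex is $d$-representable if it is the nerve of a finite family of convex sets in $\mathbb R^d$. Let $\mathsf K$ be a $d$-representable complex whose vertex set is split into pairwise disjoint sets, $N=N_1\sqcup\dots\sqcup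 N_{d+1}$, with $n_i:=|N_i|$. A colorful $d$-face is a face $A$ of $\mathsf K$ with $|A|=d+1$ and $|A\cap N_i|=1$ for every $i$. If $\mathsf K$ has at least $\alpha\, n_1\cdots n_{d+1}$ colorful $d$-faces, then there is $i\in\{1,\dots,d+1\}$ such that $\dim \mathsf K[N_i]\ge \beta\, n_i-1$, where $\mathsf K[N_i]=\{A\in\mathsf K : A\subseteq N_i\}$ and the dimension of a complex is the maximum of $|A|-1$ over its faces $A$. -/

import Mathlib

/-- A finite abstract simplicial complex with vertex set `N`: a system of subsets of `N` that is
closed under taking subsets. As usual in combinatorics, the empty set may be a face, and a vertex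
`v` need not satisfy `{v} ∈ faces` (so Mathlib's `AbstractSimplicialComplex`, whose faces are
nonempty and contain all the singletons, does not fit). -/
structure FinComplex (N : Type*) where
  /-- the faces of the complex -/
  faces : Finset (Finset N)
  down_closed : ∀ A ∈ faces, ∀ B, B ⊆ A → B ∈ faces

namespace FinComplex

/-- The dimension of a complex: the maximum of `|A| - 1` over its faces `A`. It is `-1` if the
empty set is the only face. (The complex without any face, which is never a nerve, gets `-1`.) -/
def dim {N : Type*} (K : FinComplex N) : ℤ := ((K.faces.sup Finset.card : ℕ) : ℤ) - 1

open Classical in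
/-- The induced subcomplex `K[U]`, consisting of the faces of `K` contained in `U`. -/
noncomputable def induced {N : Type*} (K : FinComplex N) (U : Finset N) : FinComplex N where
  faces := K.faces.filter (fun A => A ⊆ U)
  down_closed := by
    intro A hA B hB
    rw [Finset.mem_filter] at hA ⊢
    exact ⟨K.down_closed A hA.1 B hB, hB.trans hA.2⟩

open Classical in
/-- The nerve of a finite indexed family of sets: its vertices are the indices, so repeated sets
give distinct vertices, and its faces are the index sets of the subfamilies with nonempty
intersection (the empty subfamily has the whole space as its intersection). -/
noncomputable def nerve {X N : Type*} [Fintype N] (F : N → Set X) : FinComplex N where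
  faces := Finset.univ.filter (fun A : Finset N => (⋂ v ∈ A, F v).Nonempty)
  down_closed := by
    intro A hA B hB
    rw [Finset.mem_filter] at hA ⊢
    exact ⟨Finset.mem_univ B, hA.2.mono (Set.biInter_subset_biInter_left hB)⟩

/-- A complex is `d`-representable if it is the nerve of a finite family of convex sets in
`ℝ^d`. -/
def IsRepresentable {N : Type*} [Fintype N] (d : ℕ) (K : FinComplex N) : Prop :=
  ∃ F : N → Set (EuclideanSpace ℝ (Fin d)), (∀ v, Convex ℝ (F v)) ∧ K = nerve F

open Classical in
/-- The colorful `d`-faces of `K` with respect to the color classes `P 0, …, P d`: the faces with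
`d + 1` vertices that contain exactly one vertex of each color class. -/
noncomputable def colorfulFaces {N : Type*} {d : ℕ} (K : FinComplex N)
    (P : Fin (d + 1) → Finset N) : Finset (Finset N) :=
  K.faces.filter (fun A => A.card = d + 1 ∧ ∀ i, (A ∩ P i).card = 1)

end FinComplex

/-! Let `r i` be the largest size of an intersecting subfamily of color `i`. The core is that at
least `∏ (n i - r i)` colorful tuples have empty intersection. If every `r i < β n i`, this exceeds
`(1 - α) ∏ n i`, a contradiction. For the core, rank an intersecting tuple by the distance of its
intersection from the origin. Helly's theorem gives a color whose set can be exchanged for any of at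
least `n c - r c` others, each exchange emptying the intersection or raising the rank
(`exists_color_infDist_lt`). The polynomial method turns this into the count
(`prod_le_card_of_percolating`): a polynomial of degree below `m i` in each variable that vanishes
on `T` vanishes on the whole grid, by descending rank. -/

/-! ### Polynomial method on grids -/

/-- A set `T` of points of a finite grid that percolates, in the sense that every point outside `T`
lies on an axis-parallel line at least `m c` of whose points are in `T` or have larger rank,
has at least `∏ i, m i` points. -/
theorem prod_le_card_of_percolating {I : Type*} [Fintype I] [DecidableEq I]
    {ι : I → Type*} [∀ i, Fintype (ι i)] (m : I → ℕ)
    (hm : ∀ i, m i ≤ Fintype.card (ι i)) (T : Finset (∀ i, ι i)) (ρ : (∀ i, ι i) → ℝ)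
    (h : ∀ t, t ∉ T → ∃ (c : I) (M : Finset (ι c)), m c ≤ M.card ∧
      ∀ v ∈ M, Function.update t c v ∈ T ∨ ρ t < ρ (Function.update t c v)) :
    ∏ i, m i ≤ T.card := by
  classical
  by_contra hlt
  push Not at hlt
  let x : ∀ i, ι i → ℝ := fun i v => ((Fintype.equivFin (ι i) v : ℕ) : ℝ)
  have hx : ∀ i, Function.Injective (x i) := fun i u v huv => by
    simpa [x, Fin.val_inj] using huv
  let e : (∀ i, Fin (m i)) → (I →₀ ℕ) := fun k => Finsupp.equivFunOnFinite.symm fun i => (k i : ℕ)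
  have he : Function.Injective e := fun k l hkl => by
    ext i
    exact DFunLike.congr_fun hkl i
  let poly : ((∀ i, Fin (m i)) → ℝ) →ₗ[ℝ] MvPolynomial I ℝ :=
    ∑ k, (MvPolynomial.monomial (e k)).comp (LinearMap.proj k)
  let ev : ((∀ i, Fin (m i)) → ℝ) →ₗ[ℝ] (T → ℝ) :=
    LinearMap.pi fun t => (MvPolynomial.aeval fun i => x i (t.1 i)).toLinearMap.comp poly
  -- There are `∏ m i` coefficients and only `|T|` linear conditions.
  obtain ⟨a, ha, ha0⟩ := (Submodule.ne_bot_iff _).1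
    (LinearMap.ker_ne_bot_of_finrank_lt (f := ev) (by simpa using hlt))
  have hpoly : poly a = ∑ k, MvPolynomial.monomial (e k) (a k) := by simp [poly]
  have hT : ∀ t ∈ T, MvPolynomial.aeval (fun i => x i (t i)) (poly a) = 0 := fun t ht =>
    congrFun (LinearMap.mem_ker.1 ha) ⟨t, ht⟩
  have hall : ∀ t : ∀ i, ι i, MvPolynomial.aeval (fun i => x i (t i)) (poly a) = 0 := by
    by_contra hne
    push Not at hne
    obtain ⟨t₀, ht₀⟩ := hne
    obtain ⟨t, ht, hmax⟩ := (Finset.univ.filter fun t : ∀ i, ι i =>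
      MvPolynomial.aeval (fun i => x i (t i)) (poly a) ≠ 0).exists_max_image ρ
      ⟨t₀, Finset.mem_filter.2 ⟨Finset.mem_univ _, ht₀⟩⟩
    simp only [Finset.mem_filter, Finset.mem_univ, true_and] at ht hmax
    obtain ⟨c, M, hM, hv⟩ := h t fun h => ht (hT t h)
    have hM0 : 0 < m c := by
      by_contra h0
      have : IsEmpty (∀ i, Fin (m i)) := ⟨fun k => h0 (Nat.zero_lt_of_lt (k c).2)⟩
      exact ha0 (Subsingleton.elim _ _)
    -- The restriction of `poly a` to the line through `t` in direction `c`: its degree is below `m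
    -- c`, and it has a root at each point of `M`.
    let q : Polynomial ℝ := MvPolynomial.aeval
      (fun i => if i = c then Polynomial.X else Polynomial.C (x i (t i))) (poly a)
    have hq : ∀ v, q.eval (x c v) =
        MvPolynomial.aeval (fun i => x i (Function.update t c v i)) (poly a) := by
      intro v
      rw [← Polynomial.coe_aeval_eq_eval]
      simp only [q]
      rw [← AlgHom.comp_apply, MvPolynomial.comp_aeval]
      congr 2
      ext i
      by_cases hi : i = c
      · subst hi; simp
      · simp [hi]
    have hdeg : q.natDegree < m c := by
      have : q.natDegree ≤ m c - 1 := by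
        simp only [q, hpoly, map_sum, MvPolynomial.aeval_monomial]
        refine Polynomial.natDegree_sum_le_of_forall_le _ _ fun k _ => ?_
        refine (Polynomial.natDegree_C_mul_le _ _).trans ?_
        rw [Finsupp.prod_fintype _ _ (by simp)]
        refine (Polynomial.natDegree_prod_le _ _).trans ?_
        rw [Finset.sum_eq_single c]
        · have := (k c).2
          simp [e]
          omega
        · intro i _ hi
          rw [if_neg hi, ← Polynomial.C_pow, Polynomial.natDegree_C]
        · simp
      omega
    have hq0 : q = 0 := by
      refine Polynomial.eq_zero_of_natDegree_lt_card_of_eval_eq_zero' q (M.image (x c)) ?_ ?_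
      · intro y hy
        obtain ⟨v, hvM, rfl⟩ := Finset.mem_image.1 hy
        rw [hq]
        rcases hv v hvM with h' | h'
        · exact hT _ h'
        · by_contra h0
          exact absurd (hmax _ h0) (not_le.2 h')
      · rw [Finset.card_image_of_injective _ (hx c)]
        omega
    apply ht
    have := hq (t c)
    rw [hq0, Function.update_eq_self] at this
    simpa using this.symm
  have hzero : poly a = 0 := by
    refine MvPolynomial.eq_zero_of_eval_zero_at_prod_finset _
      (fun i => Finset.univ.image (x i)) (fun i => ?_) fun y hy => ?_
    · rw [Finset.card_image_of_injective _ (hx i), Finset.card_univ]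
      refine lt_of_lt_of_le ?_ (hm i)
      have hmi : 0 < m i := by
        by_contra h0
        have : IsEmpty (∀ i, Fin (m i)) := ⟨fun k => h0 (Nat.zero_lt_of_lt (k i).2)⟩
        exact ha0 (Subsingleton.elim _ _)
      rw [hpoly]
      refine (MvPolynomial.degreeOf_sum_le i _ _).trans_lt ((Finset.sup_lt_iff hmi).2 fun k _ => ?_)
      by_cases hk : a k = 0
      · simpa [hk] using hmi
      · rw [MvPolynomial.degreeOf_monomial_eq _ _ hk]
        exact (k i).2
    · simp only [Finset.mem_image, Finset.mem_univ, true_and] at hy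
      choose t ht using hy
      have := hall t
      rw [funext ht] at this
      exact this
  apply ha0
  funext k
  have := congrArg (MvPolynomial.coeff (e k)) hzero
  simpa [hpoly, MvPolynomial.coeff_sum, MvPolynomial.coeff_monomial, he.eq_iff] using this

/-! ### Convex geometry -/

/-- Let `t` select one set of every color, with nonempty intersection. The point `p` of the
intersection that is closest to the origin is, by Helly's theorem, already the closest point of the
intersection of all selected sets but one; hence replacing that set by one that misses `p` makes
the intersection empty or moves it away from the origin. -/
theorem exists_color_infDist_lt {E : Type*} [NormedAddCommGroup E] [InnerProductSpace ℝ E]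
    [FiniteDimensional ℝ E] {I : Type*} [Fintype I] [DecidableEq I]
    (hI : Fintype.card I = Module.finrank ℝ E + 1) {ι : I → Type*}
    (F : ∀ i, ι i → Set E) (hconv : ∀ i j, Convex ℝ (F i j)) (hclosed : ∀ i j, IsClosed (F i j))
    (t : ∀ i, ι i) (ht : (⋂ i, F i (t i)).Nonempty) :
    ∃ (c : I) (p : E), ∀ v, p ∉ F c v →
      ¬ (⋂ i, F i (Function.update t c v i)).Nonempty ∨
      Metric.infDist 0 (⋂ i, F i (t i)) <
        Metric.infDist 0 (⋂ i, F i (Function.update t c v i)) := by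
  obtain ⟨p, hp, hpd⟩ :=
    (isClosed_iInter fun i => hclosed i (t i)).exists_infDist_eq_dist ht (0 : E)
  rw [dist_zero_left] at hpd
  let G : Option I → Set E := fun o => o.elim (Metric.ball 0 ‖p‖) fun i => F i (t i)
  have hG : ¬ (⋂ o ∈ Finset.univ, G o).Nonempty := by
    rintro ⟨y, hy⟩
    simp only [Finset.mem_univ, Set.iInter_true, Set.mem_iInter, Option.forall] at hy
    have h1 : ‖y‖ < ‖p‖ := by simpa [G] using hy.1
    have h2 := Metric.infDist_le_dist_of_mem (x := (0 : E)) (Set.mem_iInter.2 hy.2)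
    rw [dist_zero_left, show (⋂ i, G (some i)) = ⋂ i, F i (t i) from rfl] at h2
    linarith
  -- Otherwise any `finrank + 1` of the selected sets and the open ball of radius `‖p‖` would meet,
  -- so by Helly all of them would.
  obtain ⟨c, hc⟩ : ∃ c, ∀ y, (∀ i, i ≠ c → y ∈ F i (t i)) → ‖p‖ ≤ ‖y‖ := by
    by_contra hcon
    push Not at hcon
    refine hG (Convex.helly_theorem (𝕜 := ℝ) (by simp [hI]) ?_ ?_)
    · rintro (_ | i) _
      · exact convex_ball _ _
      · exact hconv _ _
    · intro J _ hJ
      obtain ⟨o, ho⟩ : ∃ o, o ∉ J := by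
        by_contra! hJ'
        rw [Finset.eq_univ_of_forall hJ', Finset.card_univ, Fintype.card_option] at hJ
        omega
      rcases o with _ | c
      · obtain ⟨y, hy⟩ := ht
        refine ⟨y, Set.mem_iInter₂.2 ?_⟩
        rintro (_ | i) hi
        · exact absurd hi ho
        · exact Set.mem_iInter.1 hy i
      · obtain ⟨y, hy, hyp⟩ := hcon c
        refine ⟨y, Set.mem_iInter₂.2 ?_⟩
        rintro (_ | i) hi
        · simpa [G] using hyp
        · exact hy i fun h => ho (h ▸ hi)
  refine ⟨c, p, fun v hv => or_iff_not_imp_left.2 fun hne => ?_⟩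
  rw [not_not] at hne
  obtain ⟨q, hq, hqd⟩ := (isClosed_iInter fun i =>
    hclosed i (Function.update t c v i)).exists_infDist_eq_dist hne (0 : E)
  rw [dist_zero_left] at hqd
  rw [hpd, hqd]
  have hq' : ∀ i, i ≠ c → q ∈ F i (t i) := fun i hi => by
    simpa [hi] using Set.mem_iInter.1 hq i
  refine lt_of_le_of_ne (hc q hq') fun heq => ?_
  have hpq : p ≠ q := by
    rintro rfl
    exact hv (by simpa using Set.mem_iInter.1 hq c)
  have hmid := hc (midpoint ℝ p q) fun i hi =>
    (hconv i (t i)).midpoint_mem (Set.mem_iInter.1 hp i) (hq' i hi)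
  rw [midpoint_eq_smul_add] at hmid
  have : ‖(1 / 2 : ℝ) • (p + q)‖ < ‖p‖ := (norm_midpoint_lt_iff heq).2 hpq
  simp only [invOf_eq_inv, one_div] at this hmid
  linarith

/-- A finite family of convex sets has a subordinate family of compact convex sets with the same
nerve. -/
theorem exists_isCompact_convex_same_nerve {E : Type*} [NormedAddCommGroup E] [NormedSpace ℝ E]
    {N : Type*} [Finite N] (F : N → Set E) (hconv : ∀ v, Convex ℝ (F v)) :
    ∃ G : N → Set E, (∀ v, Convex ℝ (G v)) ∧ (∀ v, IsCompact (G v)) ∧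
      ∀ A : Set N, (⋂ v ∈ A, G v).Nonempty ↔ (⋂ v ∈ A, F v).Nonempty := by
  classical
  let w : Set N → E := fun A => if h : (⋂ v ∈ A, F v).Nonempty then h.some else 0
  have hw : ∀ A, (⋂ v ∈ A, F v).Nonempty → w A ∈ ⋂ v ∈ A, F v := fun A h => by
    simpa only [w, dif_pos h] using h.some_mem
  -- Hulls of finitely many chosen witnesses, one per intersecting subfamily; the default value of
  -- `w` never enters.
  let G : N → Set E := fun v =>
    convexHull ℝ (w '' {A | v ∈ A ∧ (⋂ v ∈ A, F v).Nonempty})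
  have hGF : ∀ v, G v ⊆ F v := fun v => by
    refine convexHull_min ?_ (hconv v)
    rintro _ ⟨A, ⟨hv, hA⟩, rfl⟩
    exact Set.mem_iInter₂.1 (hw A hA) v hv
  refine ⟨G, fun v => convex_convexHull _ _,
    fun v => ((Set.toFinite _).image _).isCompact_convexHull (𝕜 := ℝ), fun A => ⟨fun h => ?_, fun h => ?_⟩⟩
  · exact h.mono (Set.iInter₂_mono fun v _ => hGF v)
  · exact ⟨w A, Set.mem_iInter₂.2 fun v hv => subset_convexHull _ _ ⟨A, ⟨hv, h⟩, rfl⟩⟩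

/-! ### Counting colorful tuples -/

/-- The number of colorful tuples with empty intersection, if at most `r i` of the sets of color `i`
have a point in common. -/
theorem prod_sub_le_card_empty_colorful {E : Type*} [NormedAddCommGroup E]
    [InnerProductSpace ℝ E] [FiniteDimensional ℝ E] {I : Type*} [Fintype I] [DecidableEq I]
    (hI : Fintype.card I = Module.finrank ℝ E + 1) {ι : I → Type*} [∀ i, Fintype (ι i)]
    (F : ∀ i, ι i → Set E) (hconv : ∀ i j, Convex ℝ (F i j)) (r : I → ℕ)
    (hr : ∀ i (S : Finset (ι i)), (⋂ j ∈ S, F i j).Nonempty → S.card ≤ r i) :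
    ∏ i, (Fintype.card (ι i) - r i) ≤ Nat.card {t : ∀ i, ι i // ¬ (⋂ i, F i (t i)).Nonempty} := by
  classical
  obtain ⟨G, hGc, hGk, hG⟩ := exists_isCompact_convex_same_nerve
    (fun v : Σ i, ι i => F v.1 v.2) fun v => hconv _ _
  have hcol : ∀ t : ∀ i, ι i, (⋂ i, G ⟨i, t i⟩).Nonempty ↔ (⋂ i, F i (t i)).Nonempty :=
    fun t => by simpa using hG (Set.range fun i => ⟨i, t i⟩)
  have hmono : ∀ i (S : Finset (ι i)),
      (⋂ j ∈ S, G ⟨i, j⟩).Nonempty ↔ (⋂ j ∈ S, F i j).Nonempty :=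
    fun i S => by simpa using hG ((fun j => (⟨i, j⟩ : Σ i, ι i)) '' S)
  rw [Nat.card_eq_fintype_card, Fintype.card_subtype]
  refine prod_le_card_of_percolating _ (fun i => Nat.sub_le _ _) _
    (fun t => Metric.infDist 0 (⋂ i, G ⟨i, t i⟩)) fun t ht => ?_
  obtain ⟨c, p, hp⟩ := exists_color_infDist_lt hI (fun i j => G ⟨i, j⟩) (fun i j => hGc _)
    (fun i j => (hGk _).isClosed) t ((hcol t).2 (by simpa using ht))
  -- The sets of color `c` through `p` intersect, so at most `r c` of them are excluded.
  refine ⟨c, Finset.univ.filter fun v => p ∉ G ⟨c, v⟩, ?_, fun v hv => ?_⟩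
  · have h1 := hr c (Finset.univ.filter fun v => p ∈ G ⟨c, v⟩)
      ((hmono _ _).1 ⟨p, by simp⟩)
    have h2 := Finset.card_filter_add_card_filter_not (s := (Finset.univ : Finset (ι c)))
      (fun v => p ∈ G ⟨c, v⟩)
    rw [Finset.card_univ] at h2
    omega
  · refine (hp v (by simpa using hv)).imp_left fun h => ?_
    simpa [← hcol] using h

/-- The colorful fractional Helly theorem with the optimal bound. -/
theorem optimal_colorful_fractional_helly {E : Type*} [NormedAddCommGroup E]
    [InnerProductSpace ℝ E] [FiniteDimensional ℝ E] {d : ℕ} (hd : Module.finrank ℝ E = d)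
    {α : ℝ} (hα1 : α ≤ 1) {ι : Fin (d + 1) → Type*} [∀ i, Fintype (ι i)]
    [∀ i, Nonempty (ι i)] (F : ∀ i, ι i → Set E) (hconv : ∀ i j, Convex ℝ (F i j))
    (h : α * ∏ i, (Fintype.card (ι i) : ℝ) ≤
      (Nat.card {t : ∀ i, ι i // (⋂ i, F i (t i)).Nonempty} : ℝ)) :
    ∃ (i : Fin (d + 1)) (S : Finset (ι i)),
      (1 - (1 - α) ^ (1 / ((d : ℝ) + 1))) * (Fintype.card (ι i) : ℝ) ≤ (S.card : ℝ) ∧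
      (⋂ j ∈ S, F i j).Nonempty := by
  classical
  have hmax : ∀ i, ∃ S : Finset (ι i), (⋂ j ∈ S, F i j).Nonempty ∧
      ∀ S' : Finset (ι i), (⋂ j ∈ S', F i j).Nonempty → S'.card ≤ S.card := fun i => by
    obtain ⟨S, hS, hSm⟩ := (Finset.univ.filter fun S : Finset (ι i) =>
      (⋂ j ∈ S, F i j).Nonempty).exists_max_image Finset.card ⟨∅, by simp⟩
    exact ⟨S, by simpa using hS, fun S' hS' => hSm S' (by simpa using hS')⟩
  choose S hS hSm using hmax
  by_contra! hcon
  set b : ℝ := (1 - α) ^ (1 / ((d : ℝ) + 1)) with hb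
  have hb0 : 0 ≤ b := Real.rpow_nonneg (by linarith) _
  have hbpow : b ^ (d + 1) = 1 - α := by
    rw [hb, ← Real.rpow_natCast, ← Real.rpow_mul (by linarith)]
    push_cast
    rw [one_div_mul_cancel (by positivity), Real.rpow_one]
  have hlt : ∀ i, b * (Fintype.card (ι i) : ℝ) < ((Fintype.card (ι i) - (S i).card : ℕ) : ℝ) := by
    intro i
    have h1 : (1 - b) * (Fintype.card (ι i) : ℝ) ≤ (S i).card → False := fun h' =>
      (hS i).ne_empty (hcon i (S i) h')
    rw [Nat.cast_sub (Finset.card_le_univ _)]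
    by_contra h2
    exact h1 (by linarith)
  have hprod := prod_sub_le_card_empty_colorful (by simp [hd]) F hconv (fun i => (S i).card) hSm
  have hsum : Nat.card {t : ∀ i, ι i // (⋂ i, F i (t i)).Nonempty} +
      Nat.card {t : ∀ i, ι i // ¬ (⋂ i, F i (t i)).Nonempty} = ∏ i, Fintype.card (ι i) := by
    rw [Nat.card_eq_fintype_card, Nat.card_eq_fintype_card, Fintype.card_subtype_compl,
      ← Fintype.card_pi]
    exact Nat.add_sub_cancel' (Fintype.card_subtype_le _)
  have hprod' : ∏ i, b * (Fintype.card (ι i) : ℝ) <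
      ∏ i, ((Fintype.card (ι i) - (S i).card : ℕ) : ℝ) := by
    -- For `b = 0`, that is `α = 1`, the left factors vanish and the strict product inequality for
    -- positive factors does not apply.
    rcases hb0.eq_or_lt with hb' | hb'
    · rw [Finset.prod_eq_zero (Finset.mem_univ 0) (by simp [← hb'])]
      exact Finset.prod_pos fun i _ => lt_of_le_of_lt (by positivity) (hlt i)
    · exact Finset.prod_lt_prod_of_nonempty
        (fun i _ => mul_pos hb' (by exact_mod_cast Fintype.card_pos)) (fun i _ => hlt i)
        Finset.univ_nonempty
  rw [Finset.prod_mul_distrib, Finset.prod_const, Finset.card_univ, Fintype.card_fin,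
    hbpow] at hprod'
  have h3 : (∏ i, ((Fintype.card (ι i) - (S i).card : ℕ) : ℝ)) ≤
      (Nat.card {t : ∀ i, ι i // ¬ (⋂ i, F i (t i)).Nonempty} : ℝ) := by exact_mod_cast hprod
  have h4 : (Nat.card {t : ∀ i, ι i // (⋂ i, F i (t i)).Nonempty} : ℝ) +
      Nat.card {t : ∀ i, ι i // ¬ (⋂ i, F i (t i)).Nonempty} =
      ∏ i, (Fintype.card (ι i) : ℝ) := by exact_mod_cast hsum
  linarith

/-! ### Nerves -/

/-- Every colorful face of a nerve is given by a colorful tuple with nonempty intersection. -/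
theorem card_colorfulFaces_nerve_le {X N : Type*} [Fintype N] {d : ℕ} (F : N → Set X)
    (P : Fin (d + 1) → Finset N) (hdisj : ∀ i j, i ≠ j → Disjoint (P i) (P j)) :
    ((FinComplex.nerve F).colorfulFaces P).card ≤
      Nat.card {t : ∀ i, P i // (⋂ i, F (t i)).Nonempty} := by
  classical
  rw [Nat.card_eq_fintype_card, Fintype.card_subtype]
  refine (Finset.card_le_card ?_).trans
    (Finset.card_image_le (f := fun t : ∀ i, P i => Finset.univ.image fun i => (t i : N)))
  intro A hA
  simp only [FinComplex.colorfulFaces, FinComplex.nerve, Finset.mem_filter, Finset.mem_univ,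
    true_and] at hA
  obtain ⟨⟨p, hp⟩, hcard, hA⟩ := hA
  have hex : ∀ i, ∃ v, v ∈ A ∩ P i := fun i => Finset.card_pos.1 (by rw [hA i]; exact one_pos)
  choose t ht using hex
  simp only [Finset.mem_inter] at ht
  have hinj : Function.Injective t := fun i j hij => by
    by_contra hne
    exact Finset.disjoint_left.1 (hdisj i j hne) (ht i).2 (hij ▸ (ht j).2)
  simp only [Finset.mem_image, Finset.mem_filter, Finset.mem_univ, true_and]
  refine ⟨fun i => ⟨t i, (ht i).2⟩, ⟨p, Set.mem_iInter.2 fun i =>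
    Set.mem_iInter₂.1 hp _ (ht i).1⟩, Finset.eq_of_subset_of_card_le ?_ ?_⟩
  · simp only [Finset.image_subset_iff, Finset.mem_univ, true_implies]
    exact fun i => (ht i).1
  · rw [Finset.card_image_of_injective _ hinj, hcard, Finset.card_univ, Fintype.card_fin]

theorem theorem1p5 (d : ℕ) (α : ℝ) (hα0 : 0 < α) (hα1 : α ≤ 1) :
    -- families of convex sets
    (∀ (ι : Fin (d + 1) → Type*) [∀ i, Fintype (ι i)] [∀ i, Nonempty (ι i)]
        (F : ∀ i, ι i → Set (EuclideanSpace ℝ (Fin d))),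
        (∀ i j, Convex ℝ (F i j)) →
        α * ∏ i, (Fintype.card (ι i) : ℝ) ≤
          (Nat.card {t : ∀ i, ι i // (⋂ i, F i (t i)).Nonempty} : ℝ) →
        ∃ (i : Fin (d + 1)) (S : Finset (ι i)),
          (1 - (1 - α) ^ (1 / ((d : ℝ) + 1))) * (Fintype.card (ι i) : ℝ) ≤ (S.card : ℝ) ∧
          (⋂ j ∈ S, F i j).Nonempty) ∧
    -- representable complexes
    (∀ (N : Type*) [Fintype N] (K : FinComplex N) (P : Fin (d + 1) → Finset N),
        K.IsRepresentable d →
        (∀ i j, i ≠ j → Disjoint (P i) (P j)) →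
        (∀ v, ∃ i, v ∈ P i) →
        α * ∏ i, ((P i).card : ℝ) ≤ ((K.colorfulFaces P).card : ℝ) →
        ∃ i : Fin (d + 1),
          (1 - (1 - α) ^ (1 / ((d : ℝ) + 1))) * ((P i).card : ℝ) - 1 ≤
            ((K.induced (P i)).dim : ℝ)) := by
  refine ⟨fun ι _ _ F hconv h =>
    optimal_colorful_fractional_helly (by simp) hα1 F hconv h, ?_⟩
  rintro N _ K P ⟨F, hconv, rfl⟩ hdisj - h
  by_cases hP : ∀ i, (P i).Nonempty
  · have : ∀ i, Nonempty (P i) := fun i => (hP i).to_subtype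
    obtain ⟨i, S, hS, hne⟩ := optimal_colorful_fractional_helly
      (E := EuclideanSpace ℝ (Fin d)) (by simp) hα1 (fun i (v : P i) => F v) (fun i v => hconv v)
      (by
        simp only [Fintype.card_coe]
        exact h.trans (by exact_mod_cast card_colorfulFaces_nerve_le F P hdisj))
    refine ⟨i, ?_⟩
    rw [Fintype.card_coe] at hS
    have hface : S.map (Function.Embedding.subtype _) ∈
        ((FinComplex.nerve F).induced (P i)).faces := by
      simp only [FinComplex.induced, FinComplex.nerve, Finset.mem_filter, Finset.mem_univ,
        true_and]
      refine ⟨by simpa using hne, fun v hv => ?_⟩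
      obtain ⟨u, -, rfl⟩ := Finset.mem_map.1 hv
      exact u.2
    have hle := Finset.le_sup (f := Finset.card) hface
    rw [Finset.card_map] at hle
    have hle' : (S.card : ℝ) ≤
        ((((FinComplex.nerve F).induced (P i)).faces.sup Finset.card : ℕ) : ℝ) := by
      exact_mod_cast hle
    simp only [FinComplex.dim]
    push_cast
    linarith
  -- For an empty color class the bound is `-1`, the least value of `dim`.
  · push Not at hP
    obtain ⟨i, hi⟩ := hP
    refine ⟨i, ?_⟩
    simp [hi, FinComplex.dim]
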